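/- Let $p$ be an odd prime, and let $B_n$ denote the Bernoulli numbers, defined by $\frac{t}{e^t-1}=\sum_{n\ge 0}\frac{B_n}{n!}t^n$. For rational numbers $x,y$, write $x\equiv y\pmod{p^4}$ if $x-y=p^4c$ for some rational number $c$ whose denominator, in lowest terms, is not divisible by $p$. Then $$\sum_{k=0}^{p-1}\binom{p-1}{k}^3\equiv 8^{p-1}+\frac58\,p^3B_{p-3}\pmod{p^4},$$ $$\sum_{k=0}^{p-1}(-1)^k\binom{p-1}{k}^4\equiv 16^{p-1}+2p^3B_{p-3}\pmod{p^4},$$ $$\sum_{k=0}^{p-1}\binom{p-1}{k}^5\equiv 32^{p-1}+\frac{55}{12}\,p^3B_{p-3}\pmod{p^4}.$$ -/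

import Mathlib

/-- Congruence of rational numbers modulo a positive integer `m`: `x ≡ y (mod m)` when
`x - y = m * c` for a rational number `c` whose reduced denominator is coprime to `m`.
For `m = p ^ n` with `p` prime and `n ≥ 1` this says `x - y ∈ p ^ n ℤ_(p)`. -/
def RatModEq (m : ℕ) (x y : ℚ) : Prop :=
  ∃ c : ℚ, c.den.Coprime m ∧ x - y = (m : ℚ) * c

/-!
Write `p = 2h + 1`, `x = 2 ^ (p - 1) = 4 ^ h` and `a k = (-1) ^ k * choose (p - 1) k`, so that
`a k = ∏_{j ≤ k} (1 - p / j)`. Each sum in question is `S r = ∑ k, (-1) ^ k * a k ^ r`, and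
everything happens in `ZMod (p ^ 4)`. There `(a k - 1) ^ 4 = 0`, so `a k ^ r` is a linear
combination of `1`, `a k`, `a k ^ 2` and `log (a k)`, the logarithm being truncated after its cubic
term. Hence all `S r` follow from four sums, which are known exactly.

* `S 0 = 1` and `S 1 = x`.
* `S 2` is the signed central binomial coefficient (`alternating_sum_choose_sq`), which equals `x * y`
  with `y = ∏_{i ≤ h} (1 - p / (2i))` (`neg_one_pow_mul_centralBinom_eq_prod_odd`).
* `∑ k, (-1) ^ k * log (a k) = log y`: the truncated logarithm is additive (`sixLog_mul`), and an
  alternating sum of partial sums keeps the terms of even `j` (`alternating_sum_partial_sum`).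

What remains is `y - x = p³ B_{p-3} / 12` (`prod_even_eq_four_pow_add`). Squaring the product factor by
factor gives `y² = x y (1 + p² ∑ (v² + 2 p v³))` with `v = 1 / (2i)`, `i ≤ h`. Pairing `j` with
`p - j` in `∑_{j<p} 1 / j²`, over `j ≤ h` and again over even `j`, expresses `p² ∑ v²` through
`p³ ∑ v³` (`inv_squares_relation`). The same double count applied to `∑_{j<p} j ^ (p - 3)`
expresses `p³ ∑ v³` through this power sum (`power_sum_relation`), which is `p B_{p-3}`
modulo `p²` by Faulhaber's formula (`exists_sum_range_pow_eq`).
-/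

/-! ### Exact identities for sums and binomial coefficients -/

/-- Compare the coefficients of `X ^ (2 * h)` in `(1 - X) ^ n * (1 + X) ^ n = (1 - X ^ 2) ^ n`,
`n = 2 * h`. -/
theorem alternating_sum_choose_sq (h : ℕ) :
    ∑ k ∈ Finset.range (2 * h + 1), (-1 : ℤ) ^ k * ((2 * h).choose k : ℤ) ^ 2 =
      (-1) ^ h * ((2 * h).choose h : ℤ) := by
  open Polynomial in
  have hneg : ∀ k, ((1 - X : ℤ[X]) ^ (2 * h)).coeff k = (-1) ^ k * ((2 * h).choose k : ℤ) := by
    intro k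
    have : (1 - X : ℤ[X]) ^ (2 * h) = ((1 + X : ℤ[X]) ^ (2 * h)).comp (-X) := by
      simp [sub_eq_add_neg]
    rw [this, show (-X : ℤ[X]) = C (-1) * X by simp, comp_C_mul_X_coeff, coeff_one_add_X_pow]
    ring
  have hexp : (1 - X : ℤ[X]) ^ (2 * h) * (1 + X) ^ (2 * h) =
      expand ℤ 2 ((1 - X) ^ (2 * h)) := by
    rw [← mul_pow]
    simp only [map_pow, map_sub, map_one, expand_X]
    ring
  have hcoeff := congrArg (fun f : ℤ[X] => f.coeff (2 * h)) hexp
  simp only [coeff_expand_mul' two_pos, hneg] at hcoeff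
  rw [coeff_mul, Finset.Nat.sum_antidiagonal_eq_sum_range_succ_mk] at hcoeff
  rw [← hcoeff]
  refine Finset.sum_congr rfl fun k hk => ?_
  have hk' : k ≤ 2 * h := by simpa [Nat.lt_succ_iff] using hk
  simp only [hneg, coeff_one_add_X_pow, Nat.choose_symm hk']
  ring

theorem alternating_sum_partial_sum {R : Type*} [CommRing R] (f : ℕ → R) (h : ℕ) :
    ∑ k ∈ Finset.range (2 * h + 1), (-1 : R) ^ k * ∑ i ∈ Finset.range k, f i =
      ∑ i ∈ Finset.range h, f (2 * i + 1) := by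
  induction h with
  | zero => simp
  | succ h ih =>
    rw [show 2 * (h + 1) + 1 = 2 * h + 1 + 1 + 1 by ring, Finset.sum_range_succ,
      Finset.sum_range_succ, ih, Finset.sum_range_succ _ h, Finset.sum_range_succ f (2 * h + 1)]
    have : (-1 : R) ^ (2 * h) = 1 := by simp
    simp only [pow_succ, this]
    ring

/-- The index `j` stands for `j + 1`, so the pairs are `{i, p - i}` with `p = 2 * h + 1`, `i ≤ h`. -/
theorem sum_range_two_mul_eq_sum_pairs {R : Type*} [CommRing R] (f : ℕ → R) (h : ℕ) :
    ∑ j ∈ Finset.range (2 * h), f j = ∑ i ∈ Finset.range h, (f i + f (2 * h - 1 - i)) := by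
  rw [Finset.sum_add_distrib, two_mul, Finset.sum_range_add, add_right_inj,
    ← Finset.sum_range_reflect]
  refine Finset.sum_congr rfl fun i hi => ?_
  have := Finset.mem_range.1 hi
  congr 1
  omega

/-- The index `j` stands for `j + 1`, so the pairs are `{e, p - e}` with `p = 2 * h + 1`, `e` even. -/
theorem sum_range_two_mul_eq_sum_odd_pairs {R : Type*} [CommRing R] (f : ℕ → R) (h : ℕ) :
    ∑ j ∈ Finset.range (2 * h), f j =
      ∑ i ∈ Finset.range h, (f (2 * i + 1) + f (2 * h - 1 - (2 * i + 1))) := by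
  have hsplit : ∀ n, ∑ j ∈ Finset.range (2 * n), f j =
      ∑ i ∈ Finset.range n, f (2 * i + 1) + ∑ i ∈ Finset.range n, f (2 * i) := by
    intro n
    induction n with
    | zero => simp
    | succ n ih =>
      rw [show 2 * (n + 1) = 2 * n + 1 + 1 by ring, Finset.sum_range_succ, Finset.sum_range_succ,
        ih, Finset.sum_range_succ, Finset.sum_range_succ]
      ring
  rw [hsplit, Finset.sum_add_distrib, add_right_inj, ← Finset.sum_range_reflect]
  refine Finset.sum_congr rfl fun i hi => ?_
  have := Finset.mem_range.1 hi
  congr 1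
  omega

/-- Here and below, `u i` is an inverse of `i + 1`. -/
theorem neg_one_pow_mul_choose_eq_prod {R : Type*} [CommRing R] {n : ℕ} {u : ℕ → R}
    (hu : ∀ i < n, ((i : R) + 1) * u i = 1) {k : ℕ} (hk : k ≤ n) :
    (-1) ^ k * (n.choose k : R) = ∏ i ∈ Finset.range k, (1 - ((n : R) + 1) * u i) := by
  induction k with
  | zero => simp
  | succ k ih =>
    have h1 := congrArg (Nat.cast : ℕ → R) (Nat.choose_succ_right_eq n k)
    push_cast [Nat.cast_sub (show k ≤ n by omega)] at h1
    have h2 := hu k (by omega)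
    rw [Finset.prod_range_succ, ← ih (by omega), pow_succ]
    linear_combination (-(-1) ^ k * u k) * h1 + ((-1) ^ k * (n.choose k : R) +
      (-1) ^ k * (n.choose (k + 1) : R)) * h2

theorem centralBinom_mul_factorial (h : ℕ) :
    h.centralBinom * h.factorial = 2 ^ h * ∏ i ∈ Finset.range h, (2 * i + 1) := by
  induction h with
  | zero => simp
  | succ h ih =>
    have := Nat.succ_mul_centralBinom_succ h
    rw [Nat.factorial_succ, Finset.prod_range_succ, pow_succ]
    linear_combination h.factorial * this + 2 * (2 * h + 1) * ih

/-- Both sides become products of odd numbers after multiplication by `h!`: with `p = 2 * h + 1`, the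
numerators `2 * i - p` of the factors `1 - p / (2 * i)` run through `-1, -3, …, -(2 * h - 1)`. -/
theorem neg_one_pow_mul_centralBinom_eq_prod_odd {R : Type*} [CommRing R] {h : ℕ} {u : ℕ → R}
    (hu : ∀ i < 2 * h, ((i : R) + 1) * u i = 1) :
    (-1) ^ h * (h.centralBinom : R) =
      4 ^ h * ∏ i ∈ Finset.range h, (1 - (2 * (h : R) + 1) * u (2 * i + 1)) := by
  have hodd : (∏ i ∈ Finset.range h, (1 - (2 * (h : R) + 1) * u (2 * i + 1))) *
      (2 ^ h * (h.factorial : R)) = (-1) ^ h * ∏ i ∈ Finset.range h, (2 * (i : R) + 1) := by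
    have hfact : 2 ^ h * (h.factorial : R) = ∏ i ∈ Finset.range h, (2 * ((i : R) + 1)) := by
      rw [Finset.prod_mul_distrib, ← Finset.prod_range_add_one_eq_factorial]
      push_cast
      simp
    have hneg : (-1 : R) ^ h * ∏ i ∈ Finset.range h, (2 * (i : R) + 1) =
        ∏ i ∈ Finset.range h, (-(2 * (i : R) + 1)) := by
      rw [Finset.prod_neg]
      simp
    rw [hfact, hneg, ← Finset.prod_mul_distrib,
      ← Finset.prod_range_reflect (fun i => -(2 * (i : R) + 1))]
    refine Finset.prod_congr rfl fun i hi => ?_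
    have hi' := Finset.mem_range.1 hi
    have hui := hu (2 * i + 1) (by omega)
    rw [Nat.sub_sub, Nat.cast_sub (by omega)]
    push_cast at hui ⊢
    linear_combination (-(2 * (h : R) + 1)) * hui
  have hc := congrArg (Nat.cast : ℕ → R) (centralBinom_mul_factorial h)
  push_cast at hc
  have hunit : IsUnit (h.factorial : R) := by
    rw [← Finset.prod_range_add_one_eq_factorial, Nat.cast_prod]
    refine Finset.prod_induction _ IsUnit (fun _ _ => IsUnit.mul) isUnit_one fun i hi => ?_
    have hi' := Finset.mem_range.1 hi
    exact IsUnit.of_mul_eq_one (u i) (by simpa using hu i (by omega))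
  apply hunit.mul_right_cancel
  rw [show (4 : R) ^ h = 2 ^ h * 2 ^ h by rw [← mul_pow]; norm_num]
  linear_combination (-1) ^ h * hc - 2 ^ h * hodd

/-! ### Rings in which `q ^ 4 = 0` -/

section Truncated

variable {R : Type*} [CommRing R] {q : R}

/-- Six times the logarithm series at `z`, truncated after its cubic term; the factor `6` clears
the denominators. -/
def sixLog (z : R) : R := 6 * (z - 1) - 3 * (z - 1) ^ 2 + 2 * (z - 1) ^ 3

theorem sixLog_mul (hq : q ^ 4 = 0) {x y : R} (hx : q ∣ x - 1) (hy : q ∣ y - 1) :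
    sixLog (x * y) = sixLog x + sixLog y := by
  obtain ⟨a, ha⟩ := hx
  obtain ⟨b, hb⟩ := hy
  obtain rfl : x = 1 + q * a := by linear_combination ha
  obtain rfl : y = 1 + q * b := by linear_combination hb
  unfold sixLog
  linear_combination (-3 * a ^ 2 * b ^ 2 + 6 * (a + b) ^ 2 * a * b
    + 6 * q * (a + b) * a ^ 2 * b ^ 2 + 2 * q ^ 2 * a ^ 3 * b ^ 3) * hq

theorem dvd_prod_one_sub_mul_sub_one (u : ℕ → R) (k : ℕ) :
    q ∣ ∏ i ∈ Finset.range k, (1 - q * u i) - 1 := by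
  induction k with
  | zero => simp
  | succ k ih =>
    obtain ⟨c, hc⟩ := ih
    rw [Finset.prod_range_succ]
    exact ⟨c - u k - q * u k * c, by linear_combination (1 - q * u k) * hc⟩

theorem sixLog_prod (hq : q ^ 4 = 0) (u : ℕ → R) (k : ℕ) :
    sixLog (∏ i ∈ Finset.range k, (1 - q * u i)) =
      ∑ i ∈ Finset.range k, sixLog (1 - q * u i) := by
  induction k with
  | zero => simp [sixLog]
  | succ k ih =>
    rw [Finset.prod_range_succ, Finset.sum_range_succ,
      sixLog_mul hq (dvd_prod_one_sub_mul_sub_one u k) ⟨-u k, by ring⟩, ih]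

theorem prod_one_add_sq_mul (hq : q ^ 4 = 0) (c : ℕ → R) (k : ℕ) :
    ∏ i ∈ Finset.range k, (1 + q ^ 2 * c i) = 1 + q ^ 2 * ∑ i ∈ Finset.range k, c i := by
  induction k with
  | zero => simp
  | succ k ih =>
    rw [Finset.prod_range_succ, Finset.sum_range_succ, ih]
    linear_combination (∑ i ∈ Finset.range k, c i) * c k * hq

/-- Each factor satisfies `(1 - q v)² = (1 - 2 q v) * (1 + q² v² + 2 q³ v³)` modulo `q ^ 4`. -/
theorem prod_one_sub_mul_sq (hq : q ^ 4 = 0) (v : ℕ → R) (k : ℕ) :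
    (∏ i ∈ Finset.range k, (1 - q * v i)) ^ 2 =
      (∏ i ∈ Finset.range k, (1 - q * (2 * v i))) *
        (1 + q ^ 2 * ∑ i ∈ Finset.range k, (v i ^ 2 + 2 * q * v i ^ 3)) := by
  rw [← prod_one_add_sq_mul hq, ← Finset.prod_pow, ← Finset.prod_mul_distrib]
  refine Finset.prod_congr rfl fun i _ => ?_
  linear_combination 4 * v i ^ 4 * hq

theorem isUnit_of_dvd_sub_one (hq : q ^ 4 = 0) {y : R} (hy : q ∣ y - 1) : IsUnit y := by
  obtain ⟨a, ha⟩ := hy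
  obtain rfl : y = 1 + q * a := by linear_combination ha
  exact IsUnit.of_mul_eq_one (1 - q * a + q ^ 2 * a ^ 2 - q ^ 3 * a ^ 3)
    (by linear_combination -a ^ 4 * hq)

theorem sq_mul_inv_sub_sq (hq : q ^ 4 = 0) {a v w : R} (hv : a * v = 1) (hw : (q - a) * w = 1) :
    q ^ 2 * w ^ 2 = q ^ 2 * v ^ 2 + 2 * q ^ 3 * v ^ 3 := by
  have hw' : w = -v - q * v ^ 2 + q ^ 2 * (v ^ 2 * w) := by
    linear_combination (-v - q * v ^ 2) * hw - (w + q * v * w) * hv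
  generalize v ^ 2 * w = e at hw'
  subst hw'
  linear_combination (v ^ 4 - 2 * v * e - 2 * q * v ^ 2 * e + q ^ 2 * e ^ 2) * hq

theorem sq_mul_sub_pow (hq : q ^ 4 = 0) (a : R) (n : ℕ) :
    q ^ 2 * (q - a) ^ (2 * n + 2) =
      q ^ 2 * a ^ (2 * n + 2) - (2 * n + 2) * q ^ 3 * a ^ (2 * n + 1) := by
  obtain ⟨k, hk⟩ := Polynomial.powAddExpansion (-a) q (2 * n + 2)
  have h1 : (-a) ^ (2 * n + 2) = a ^ (2 * n + 2) := Even.neg_pow ⟨n + 1, by ring⟩ a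
  have h2 : (-a) ^ (2 * n + 1) = -a ^ (2 * n + 1) := Odd.neg_pow ⟨n, rfl⟩ a
  rw [show 2 * n + 2 - 1 = 2 * n + 1 by omega, h1, h2] at hk
  push_cast at hk
  rw [show q - a = -a + q by ring, hk]
  linear_combination k * hq

theorem inv_eq_two_mul_inv {u : ℕ → R} {h : ℕ} (hu : ∀ i < 2 * h, ((i : R) + 1) * u i = 1)
    {i : ℕ} (hi : i < h) : u i = 2 * u (2 * i + 1) := by
  have h1 := hu i (by omega)
  have h2 := hu (2 * i + 1) (by omega)
  push_cast at h2
  linear_combination 2 * u (2 * i + 1) * h1 - u i * h2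

/-- Evaluate `q² ∑ 1 / j²` over `1 ≤ j ≤ 2 * h` in two ways, pairing `j` with `q - j` for `j ≤ h` and for
`j` even. -/
theorem inv_squares_relation (hq : q ^ 4 = 0) {h : ℕ} (hqh : q = 2 * (h : R) + 1) {u : ℕ → R}
    (hu : ∀ i < 2 * h, ((i : R) + 1) * u i = 1) :
    6 * (q ^ 2 * ∑ i ∈ Finset.range h, u (2 * i + 1) ^ 2) =
      -14 * (q ^ 3 * ∑ i ∈ Finset.range h, u (2 * i + 1) ^ 3) := by
  have hrefl : ∀ i < 2 * h,
      q ^ 2 * u (2 * h - 1 - i) ^ 2 = q ^ 2 * u i ^ 2 + 2 * q ^ 3 * u i ^ 3 := by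
    intro i hi
    refine sq_mul_inv_sub_sq hq (hu i hi) ?_
    have := hu (2 * h - 1 - i) (by omega)
    rw [Nat.sub_sub, Nat.cast_sub (by omega)] at this
    push_cast at this
    rw [Nat.sub_sub, hqh]
    linear_combination this
  have h1 : q ^ 2 * ∑ j ∈ Finset.range (2 * h), u j ^ 2 =
      8 * (q ^ 2 * ∑ i ∈ Finset.range h, u (2 * i + 1) ^ 2) +
        16 * (q ^ 3 * ∑ i ∈ Finset.range h, u (2 * i + 1) ^ 3) := by
    rw [sum_range_two_mul_eq_sum_pairs]
    simp only [Finset.mul_sum, ← Finset.sum_add_distrib]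
    refine Finset.sum_congr rfl fun i hi => ?_
    have hi' := Finset.mem_range.1 hi
    rw [mul_add, hrefl i (by omega), inv_eq_two_mul_inv hu hi']
    ring
  have h2 : q ^ 2 * ∑ j ∈ Finset.range (2 * h), u j ^ 2 =
      2 * (q ^ 2 * ∑ i ∈ Finset.range h, u (2 * i + 1) ^ 2) +
        2 * (q ^ 3 * ∑ i ∈ Finset.range h, u (2 * i + 1) ^ 3) := by
    rw [sum_range_two_mul_eq_sum_odd_pairs]
    simp only [Finset.mul_sum, ← Finset.sum_add_distrib]
    refine Finset.sum_congr rfl fun i hi => ?_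
    have hi' := Finset.mem_range.1 hi
    rw [mul_add, hrefl _ (by omega)]
    ring
  linear_combination h2 - h1

/-- The double count of `inv_squares_relation` for `q² ∑ j ^ (q - 3)`; the exponent `q - 3` acts as
`-3` on multiples of `q ^ 3`. -/
theorem power_sum_relation (hq : q ^ 4 = 0) {g : ℕ} (hqg : q = 2 * ((g + 2 : ℕ) : R) + 1) :
    (2 ^ (2 * g + 2) - 1) *
        (q ^ 2 * ∑ j ∈ Finset.range (2 * (g + 2)), ((j : R) + 1) ^ (2 * g + 2)) =
      3 * (q ^ 3 * ∑ i ∈ Finset.range (g + 2), (2 * (i : R) + 2) ^ (2 * g + 1)) := by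
  have hrefl : ∀ i < 2 * (g + 2),
      q ^ 2 * (((2 * (g + 2) - 1 - i : ℕ) : R) + 1) ^ (2 * g + 2) =
        q ^ 2 * ((i : R) + 1) ^ (2 * g + 2) + 3 * q ^ 3 * ((i : R) + 1) ^ (2 * g + 1) := by
    intro i hi
    rw [Nat.sub_sub, Nat.cast_sub (by omega)]
    push_cast at hqg ⊢
    rw [show 2 * ((g : R) + 2) - (1 + i) + 1 = q - (i + 1) by rw [hqg]; ring, sq_mul_sub_pow hq]
    rw [show (2 * (g : R) + 2) = q - 3 by rw [hqg]; ring]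
    linear_combination -((i : R) + 1) ^ (2 * g + 1) * hq
  have h1 : 2 ^ (2 * g + 2) *
        (q ^ 2 * ∑ j ∈ Finset.range (2 * (g + 2)), ((j : R) + 1) ^ (2 * g + 2)) =
      2 * (q ^ 2 * ∑ i ∈ Finset.range (g + 2), (2 * (i : R) + 2) ^ (2 * g + 2)) +
        6 * (q ^ 3 * ∑ i ∈ Finset.range (g + 2), (2 * (i : R) + 2) ^ (2 * g + 1)) := by
    rw [sum_range_two_mul_eq_sum_pairs]
    simp only [Finset.mul_sum, ← Finset.sum_add_distrib]
    refine Finset.sum_congr rfl fun i hi => ?_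
    have hi' := Finset.mem_range.1 hi
    rw [mul_add, hrefl i (by omega), show 2 * (i : R) + 2 = 2 * (i + 1) by ring, mul_pow, mul_pow]
    ring
  have h2 : q ^ 2 * ∑ j ∈ Finset.range (2 * (g + 2)), ((j : R) + 1) ^ (2 * g + 2) =
      2 * (q ^ 2 * ∑ i ∈ Finset.range (g + 2), (2 * (i : R) + 2) ^ (2 * g + 2)) +
        3 * (q ^ 3 * ∑ i ∈ Finset.range (g + 2), (2 * (i : R) + 2) ^ (2 * g + 1)) := by
    rw [sum_range_two_mul_eq_sum_odd_pairs]
    simp only [Finset.mul_sum, ← Finset.sum_add_distrib]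
    refine Finset.sum_congr rfl fun i hi => ?_
    have hi' := Finset.mem_range.1 hi
    rw [mul_add, hrefl _ (by omega)]
    push_cast
    ring
  linear_combination h1 - h2

/-- The difference of `∏ (1 - q / (2 * i))` and `4 ^ h`, where `h = g + 2` and `q = 2 * h + 1`, in terms
of the power sum with exponent `q - 3`. -/
theorem prod_even_eq_four_pow_add (hq : q ^ 4 = 0) {g : ℕ}
    (hqg : q = 2 * ((g + 2 : ℕ) : R) + 1) {u : ℕ → R}
    (hu : ∀ i < 2 * (g + 2), ((i : R) + 1) * u i = 1) (h3 : IsUnit (3 : R))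
    (hfermat : ∀ i < 2 * (g + 2), q ∣ ((i : R) + 1) ^ (2 * (g + 2)) - 1) {β : R}
    (hβ : q ^ 2 * ∑ j ∈ Finset.range (2 * (g + 2)), ((j : R) + 1) ^ (2 * g + 2) = q ^ 3 * β) :
    ∃ c, ∏ i ∈ Finset.range (g + 2), (1 - q * u (2 * i + 1)) = 4 ^ (g + 2) + q ^ 3 * c ∧
      12 * (q ^ 3 * c) = q ^ 3 * β := by
  set h := g + 2 with hh
  have hx : q ∣ (4 : R) ^ h - 1 := by
    have := hfermat 1 (by omega)
    rw [pow_mul] at this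
    norm_num at this
    exact this
  set V2 := ∑ i ∈ Finset.range h, u (2 * i + 1) ^ 2 with hV2
  set V3 := ∑ i ∈ Finset.range h, u (2 * i + 1) ^ 3 with hV3
  have hsq := inv_squares_relation hq hqg hu
  rw [← hV2, ← hV3] at hsq
  have hpow := power_sum_relation hq hqg
  rw [← hh, hβ] at hpow
  -- By Fermat, `e ^ (q - 4)` and `e ^ (-3)` agree modulo `q`.
  have hW : q ^ 3 * ∑ i ∈ Finset.range h, (2 * (i : R) + 2) ^ (2 * g + 1) = q ^ 3 * V3 := by
    simp only [hV3, Finset.mul_sum]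
    refine Finset.sum_congr rfl fun i hi => ?_
    have hi' := Finset.mem_range.1 hi
    have hui := hu (2 * i + 1) (by omega)
    obtain ⟨c, hc⟩ := hfermat (2 * i + 1) (by omega)
    push_cast at hui hc
    rw [show 2 * (i : R) + 1 + 1 = 2 * i + 2 by ring] at hui hc
    rw [show 2 * h = 2 * g + 1 + 3 by omega, pow_add] at hc
    have hcube : (2 * (i : R) + 2) ^ 3 * u (2 * i + 1) ^ 3 = 1 := by
      rw [← mul_pow, hui, one_pow]
    linear_combination u (2 * i + 1) ^ 3 * q ^ 3 * hc + c * u (2 * i + 1) ^ 3 * hq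
      - q ^ 3 * (2 * (i : R) + 2) ^ (2 * g + 1) * hcube
  obtain ⟨b, hb⟩ := hx
  have hβV : q ^ 3 * β = -4 * (q ^ 3 * V3) := by
    have h4 : (4 : R) * 2 ^ (2 * g + 2) = 4 ^ h := by
      rw [hh, show 2 * g + 2 = 2 * (g + 1) by ring, pow_mul, pow_succ _ (g + 1)]
      norm_num [mul_comm]
    apply h3.mul_left_cancel
    rw [hW] at hpow
    linear_combination -4 * hpow + q ^ 3 * β * h4 + q ^ 3 * β * hb + b * β * hq
  have hprod := prod_one_sub_mul_sq hq (fun i => u (2 * i + 1)) h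
  have hM : ∏ i ∈ Finset.range h, (1 - q * (2 * u (2 * i + 1))) =
      4 ^ h * ∏ i ∈ Finset.range h, (1 - q * u (2 * i + 1)) := by
    rw [hqg, ← neg_one_pow_mul_centralBinom_eq_prod_odd hu, Nat.centralBinom_eq_two_mul_choose,
      neg_one_pow_mul_choose_eq_prod hu (by omega)]
    refine Finset.prod_congr rfl fun i hi => ?_
    rw [inv_eq_two_mul_inv hu (Finset.mem_range.1 hi)]
    push_cast
    ring
  have hT : 12 * (q ^ 2 * ∑ i ∈ Finset.range h, (u (2 * i + 1) ^ 2 + 2 * q * u (2 * i + 1) ^ 3)) =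
      q ^ 3 * β := by
    rw [Finset.sum_add_distrib, ← Finset.mul_sum, ← hV2, ← hV3, hβV]
    linear_combination 2 * hsq
  have hy := dvd_prod_one_sub_mul_sub_one (q := q) (fun i => u (2 * i + 1)) h
  set y := ∏ i ∈ Finset.range h, (1 - q * u (2 * i + 1))
  rw [hM] at hprod
  set T := q ^ 2 * ∑ i ∈ Finset.range h, (u (2 * i + 1) ^ 2 + 2 * q * u (2 * i + 1) ^ 3)
  have hyT : y = 4 ^ h * (1 + T) :=
    (isUnit_of_dvd_sub_one hq hy).mul_left_cancel (by linear_combination hprod)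
  obtain ⟨s, hs⟩ := h3.exists_right_inv
  have h2 := hu 1 (by omega)
  norm_num at h2
  have hTc : T = q ^ 3 * (u 1 ^ 2 * s * β) := by
    linear_combination u 1 ^ 2 * s * hT - 4 * u 1 ^ 2 * T * hs - T * (2 * u 1 + 1) * h2
  refine ⟨u 1 ^ 2 * s * β, ?_, by rw [← hTc, hT]⟩
  linear_combination hyT + 4 ^ h * hTc + q ^ 3 * (u 1 ^ 2 * s * β) * hb
    + b * (u 1 ^ 2 * s * β) * hq

/-- The sums `∑ (-1) ^ k * a k ^ r` for `a k = (-1) ^ k * choose (2 * h) k` and `r = 3, 4, 5`, given the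
difference of `∏ (1 - q / (2 * i))` and `4 ^ h`. -/
theorem alternating_power_sums (hq : q ^ 4 = 0) {h : ℕ} (hqh : q = 2 * (h : R) + 1) {u : ℕ → R}
    (hu : ∀ i < 2 * h, ((i : R) + 1) * u i = 1) (h2 : IsUnit (2 : R))
    (hx : q ∣ (4 : R) ^ h - 1) {c : R}
    (hy : ∏ i ∈ Finset.range h, (1 - q * u (2 * i + 1)) = 4 ^ h + q ^ 3 * c) :
    2 * ∑ k ∈ Finset.range (2 * h + 1), ((2 * h).choose k : R) ^ 3 =
        2 * (4 ^ h) ^ 3 + 15 * (q ^ 3 * c) ∧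
      ∑ k ∈ Finset.range (2 * h + 1), (-1) ^ k * ((2 * h).choose k : R) ^ 4 =
        (4 ^ h) ^ 4 + 24 * (q ^ 3 * c) ∧
      2 * ∑ k ∈ Finset.range (2 * h + 1), ((2 * h).choose k : R) ^ 5 =
        2 * (4 ^ h) ^ 5 + 110 * (q ^ 3 * c) := by
  set a : ℕ → R := fun k => ∏ i ∈ Finset.range k, (1 - q * u i) with ha
  set S : ℕ → R := fun r => ∑ k ∈ Finset.range (2 * h + 1), (-1) ^ k * a k ^ r with hS
  have hchoose : ∀ k ∈ Finset.range (2 * h + 1), (-1) ^ k * ((2 * h).choose k : R) = a k := by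
    intro k hk
    rw [neg_one_pow_mul_choose_eq_prod hu (by simpa [Nat.lt_succ_iff] using hk), ha, hqh]
    push_cast
    rfl
  have hsign : ∀ k : ℕ, ((-1 : R) ^ k) ^ 2 = 1 := fun k => by rw [← pow_mul]; simp
  have S0 : S 0 = 1 := by
    simp only [hS, pow_zero, mul_one]
    rw [neg_one_geom_sum, if_neg (by simp)]
  have S1 : S 1 = 4 ^ h := by
    have hrow := congrArg (Nat.cast : ℕ → R) (Nat.sum_range_choose (2 * h))
    push_cast [pow_mul] at hrow
    rw [← hrow]
    refine Finset.sum_congr rfl fun k hk => ?_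
    rw [← hchoose k hk]
    linear_combination ((2 * h).choose k : R) * hsign k
  have S2 : S 2 = 4 ^ h * (4 ^ h + q ^ 3 * c) := by
    have hrow := congrArg (Int.cast : ℤ → R) (alternating_sum_choose_sq h)
    push_cast at hrow
    rw [← hy, hqh, ← neg_one_pow_mul_centralBinom_eq_prod_odd hu,
      Nat.centralBinom_eq_two_mul_choose, ← hrow]
    refine Finset.sum_congr rfl fun k hk => ?_
    rw [← hchoose k hk]
    linear_combination (-1) ^ k * ((2 * h).choose k : R) ^ 2 * hsign k
  have SL : ∑ k ∈ Finset.range (2 * h + 1), (-1) ^ k * sixLog (a k) =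
      sixLog (4 ^ h + q ^ 3 * c) := by
    simp only [ha, sixLog_prod hq]
    rw [alternating_sum_partial_sum, ← sixLog_prod hq fun i => u (2 * i + 1), hy]
  -- By definition of `sixLog`, `a ^ 3` is a combination of `1`, `a`, `a ^ 2` and `sixLog a`.
  have S3 : 2 * S 3 = 9 * S 2 - 18 * S 1 + 11 * S 0 + sixLog (4 ^ h + q ^ 3 * c) := by
    rw [← SL]
    simp only [hS, Finset.mul_sum, ← Finset.sum_add_distrib, ← Finset.sum_sub_distrib]
    refine Finset.sum_congr rfl fun k _ => ?_
    unfold sixLog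
    ring
  have hrec : ∀ r, S (r + 4) = 4 * S (r + 3) - 6 * S (r + 2) + 4 * S (r + 1) - S r := by
    intro r
    simp only [hS, Finset.mul_sum, ← Finset.sum_add_distrib, ← Finset.sum_sub_distrib]
    refine Finset.sum_congr rfl fun k _ => ?_
    obtain ⟨e, he⟩ : q ∣ a k - 1 := dvd_prod_one_sub_mul_sub_one u k
    have h4 : (a k - 1) ^ 4 = 0 := by rw [he, mul_pow, hq, zero_mul]
    linear_combination (-1) ^ k * a k ^ r * h4
  have C3 : ∑ k ∈ Finset.range (2 * h + 1), ((2 * h).choose k : R) ^ 3 = S 3 := by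
    refine Finset.sum_congr rfl fun k hk => ?_
    rw [← hchoose k hk]
    linear_combination -((2 * h).choose k : R) ^ 3 * (((-1) ^ k) ^ 2 + 1) * hsign k
  have C4 : ∑ k ∈ Finset.range (2 * h + 1), (-1) ^ k * ((2 * h).choose k : R) ^ 4 = S 4 := by
    refine Finset.sum_congr rfl fun k hk => ?_
    rw [← hchoose k hk]
    linear_combination -(-1) ^ k * ((2 * h).choose k : R) ^ 4 * (((-1) ^ k) ^ 2 + 1) * hsign k
  have C5 : ∑ k ∈ Finset.range (2 * h + 1), ((2 * h).choose k : R) ^ 5 = S 5 := by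
    refine Finset.sum_congr rfl fun k hk => ?_
    rw [← hchoose k hk]
    linear_combination
      -((2 * h).choose k : R) ^ 5 * (((-1) ^ k) ^ 4 + ((-1) ^ k) ^ 2 + 1) * hsign k
  rw [C3, C4, C5]
  clear_value S
  obtain ⟨b, hb⟩ := hx
  generalize (4 : R) ^ h = x at *
  obtain rfl : x = 1 + q * b := by linear_combination hb
  unfold sixLog at S3
  have T3 : 2 * S 3 = 2 * (1 + q * b) ^ 3 + 15 * (q ^ 3 * c) := by
    rw [S3, S2, S1, S0]
    linear_combination (2 * q ^ 5 * c ^ 3 + 6 * q ^ 3 * b * c ^ 2 - 3 * q ^ 2 * c ^ 2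
      + 6 * q * b ^ 2 * c + 3 * b * c) * hq
  have T4 : S 4 = (1 + q * b) ^ 4 + 24 * (q ^ 3 * c) := by
    apply h2.mul_left_cancel
    have := hrec 0
    norm_num at this
    rw [this, S2, S1, S0]
    linear_combination 4 * T3 - (12 * b * c + 2 * b ^ 4) * hq
  refine ⟨T3, T4, ?_⟩
  have := hrec 1
  norm_num at this
  rw [this, S2, S1, T4]
  linear_combination -6 * T3 + (8 * b * c - 2 * b ^ 4 * (1 + q * b)) * hq

end Truncated

/-! ### Bernoulli numbers and power sums -/

theorem den_coprime_of_mem_integer {p : ℕ} [Fact p.Prime] {x : ℚ}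
    (hx : x ∈ (Rat.padicValuation p).integer) : x.den.Coprime p :=
  ((Nat.Prime.coprime_iff_not_dvd Fact.out).2 (Rat.padicValuation_le_one_iff.1 hx)).symm

theorem inv_natCast_mem_integer {p : ℕ} [Fact p.Prime] {n : ℕ} (h0 : 0 < n) (hn : n < p) :
    (n : ℚ)⁻¹ ∈ (Rat.padicValuation p).integer := by
  rw [Valuation.mem_integer_iff, Rat.padicValuation_le_one_iff, Rat.inv_natCast_den_of_pos h0]
  exact Nat.not_dvd_of_pos_of_lt h0 hn

theorem bernoulli'_mem_integer {p : ℕ} [Fact p.Prime] {n : ℕ} (hn : n + 1 < p) :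
    bernoulli' n ∈ (Rat.padicValuation p).integer := by
  induction n using Nat.strong_induction_on with
  | _ n ih =>
    rw [bernoulli'_def]
    refine sub_mem (one_mem _) (sum_mem fun k hk => ?_)
    have hk' := Finset.mem_range.1 hk
    refine mul_mem ?_ (ih k hk' (by omega))
    rw [div_eq_mul_inv]
    refine mul_mem (natCast_mem _ _) ?_
    rw [show (n : ℚ) - k + 1 = ((n - k + 1 : ℕ) : ℚ) by push_cast [Nat.cast_sub hk'.le]; ring]
    exact inv_natCast_mem_integer (by omega) (by omega)

theorem bernoulli_mem_integer {p : ℕ} [Fact p.Prime] {n : ℕ} (hn : n + 1 < p) :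
    bernoulli n ∈ (Rat.padicValuation p).integer := by
  rw [bernoulli]
  exact mul_mem (pow_mem (neg_mem (one_mem _)) _) (bernoulli'_mem_integer hn)

/-- Faulhaber's formula modulo `p ^ 2`: all Bernoulli numbers in it have index below `p - 1`, hence are
`p`-integral, and only the last one comes with a single factor `p`. -/
theorem exists_sum_range_pow_eq {p : ℕ} [Fact p.Prime] {m : ℕ} (hm : m + 1 < p) :
    ∃ c ∈ (Rat.padicValuation p).integer,
      ∑ k ∈ Finset.range p, (k : ℚ) ^ m = p * bernoulli m + p ^ 2 * c := by
  refine ⟨∑ i ∈ Finset.range m,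
    bernoulli i * (m + 1).choose i * (p : ℚ) ^ (m - 1 - i) * ((m + 1 : ℕ) : ℚ)⁻¹, ?_, ?_⟩
  · refine sum_mem fun i hi => ?_
    have hi' := Finset.mem_range.1 hi
    exact mul_mem (mul_mem (mul_mem (bernoulli_mem_integer (by omega)) (natCast_mem _ _))
      (pow_mem (natCast_mem _ _) _)) (inv_natCast_mem_integer (by omega) hm)
  · have hm0 : (m : ℚ) + 1 ≠ 0 := by positivity
    rw [sum_range_pow, Finset.sum_range_succ, add_comm, Finset.mul_sum]
    congr 1
    · rw [Nat.choose_succ_self_right, show m + 1 - m = 1 by omega]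
      push_cast
      field_simp
    · refine Finset.sum_congr rfl fun i hi => ?_
      have hi' := Finset.mem_range.1 hi
      rw [show m + 1 - i = 2 + (m - 1 - i) by omega, pow_add]
      push_cast
      field_simp

theorem isUnit_natCast_zmod {p n : ℕ} (e : ℕ) (hn : n.Coprime p) :
    IsUnit (n : ZMod (p ^ e)) :=
  (ZMod.isUnit_iff_coprime n _).2 (hn.pow_right e)

/-- `exists_sum_range_pow_eq` multiplied by `p ^ 2`, read in `ZMod (p ^ 4)` and cleared of the
denominator of `bernoulli m`. -/
theorem sq_mul_power_sum_eq {p : ℕ} [Fact p.Prime] {m : ℕ} (hm0 : m ≠ 0) (hm : m + 1 < p) :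
    (p : ZMod (p ^ 4)) ^ 2 * (∑ j ∈ Finset.range (p - 1), ((j : ZMod (p ^ 4)) + 1) ^ m) *
      (bernoulli m).den = (p : ZMod (p ^ 4)) ^ 3 * (bernoulli m).num := by
  obtain ⟨c, hc, hsum⟩ := exists_sum_range_pow_eq hm
  have hcden : c.den.Coprime p := den_coprime_of_mem_integer hc
  have hp4 : (p : ZMod (p ^ 4)) ^ 4 = 0 := by
    have := ZMod.natCast_self (p ^ 4)
    push_cast at this
    exact this
  rw [← Nat.sub_add_cancel (Nat.Prime.one_le (p := p) Fact.out), Finset.sum_range_succ',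
    Nat.sub_add_cancel (Nat.Prime.one_le (p := p) Fact.out)] at hsum
  simp only [Nat.cast_zero, zero_pow hm0, add_zero] at hsum
  have hint : ((∑ j ∈ Finset.range (p - 1), ((j : ℤ) + 1) ^ m) * (bernoulli m).den * c.den : ℤ) =
      p * (bernoulli m).num * c.den + p ^ 2 * c.num * (bernoulli m).den := by
    have hB := Rat.mul_den_eq_num (bernoulli m)
    have hC := Rat.mul_den_eq_num c
    have : ((∑ j ∈ Finset.range (p - 1), ((j : ℚ) + 1) ^ m) * (bernoulli m).den * c.den : ℚ) =
        p * (bernoulli m).num * c.den + p ^ 2 * c.num * (bernoulli m).den := by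
      push_cast at hsum
      rw [hsum, ← hB, ← hC]
      ring
    exact_mod_cast this
  have hR := congrArg (Int.cast : ℤ → ZMod (p ^ 4)) hint
  push_cast at hR
  apply (isUnit_natCast_zmod 4 hcden).mul_right_cancel
  linear_combination (p : ZMod (p ^ 4)) ^ 2 * hR + (c.num : ZMod (p ^ 4)) * (bernoulli m).den * hp4

/-! ### Passage between `ZMod (p ^ 4)` and rational congruences -/

/-- A congruence of rationals follows from its version in `ZMod (p ^ n)` cleared of denominators. -/
theorem ratModEq_of_zmod {p n a b : ℕ} {B : ℚ} (hb0 : b ≠ 0)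
    (hb : b.Coprime p)
    (hB : B.den.Coprime p) {X Y : ℤ}
    (h : (b : ZMod (p ^ n)) * ((X : ZMod (p ^ n)) - Y) * B.den = a * p ^ 3 * B.num) :
    RatModEq (p ^ n) X (Y + (a / b : ℚ) * (p : ℚ) ^ 3 * B) := by
  obtain ⟨w, hw⟩ : ((p ^ n : ℕ) : ℤ) ∣ b * (X - Y) * B.den - a * p ^ 3 * B.num := by
    rw [← ZMod.intCast_zmod_eq_zero_iff_dvd]
    push_cast
    rw [h, sub_self]
  have hw' := congrArg (Int.cast : ℤ → ℚ) hw
  push_cast at hw'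
  refine ⟨w / ((b * B.den : ℕ) : ℤ), ?_, ?_⟩
  · have hdvd := Rat.den_dvd w ((b * B.den : ℕ) : ℤ)
    rw [Rat.divInt_eq_div, Int.natCast_dvd_natCast] at hdvd
    exact Nat.Coprime.coprime_dvd_left hdvd ((hb.mul_left hB).pow_right n)
  · have hB' := Rat.mul_den_eq_num B
    have hbq : (b : ℚ) ≠ 0 := by exact_mod_cast hb0
    have hdq : (B.den : ℚ) ≠ 0 := by exact_mod_cast B.den_ne_zero
    push_cast
    rw [← mul_div_assoc, ← hw', ← hB']
    field_simp
    ring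

/-- The three congruences in `ZMod (p ^ 4)`, cleared of denominators, for `p = 2 * (g + 2) + 1`. -/
theorem power_sums_zmod {p g : ℕ} (hp : p.Prime) (hpg : p = 2 * (g + 2) + 1) :
    ((8 : ℕ) : ZMod (p ^ 4)) * ((∑ k ∈ Finset.range (2 * (g + 2) + 1),
        ((2 * (g + 2)).choose k : ZMod (p ^ 4)) ^ 3) - 8 ^ (2 * (g + 2))) *
        (bernoulli (2 * g + 2)).den = (5 : ℕ) * p ^ 3 * (bernoulli (2 * g + 2)).num ∧
      ((1 : ℕ) : ZMod (p ^ 4)) * ((∑ k ∈ Finset.range (2 * (g + 2) + 1),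
        (-1) ^ k * ((2 * (g + 2)).choose k : ZMod (p ^ 4)) ^ 4) - 16 ^ (2 * (g + 2))) *
        (bernoulli (2 * g + 2)).den = (2 : ℕ) * p ^ 3 * (bernoulli (2 * g + 2)).num ∧
      ((12 : ℕ) : ZMod (p ^ 4)) * ((∑ k ∈ Finset.range (2 * (g + 2) + 1),
        ((2 * (g + 2)).choose k : ZMod (p ^ 4)) ^ 5) - 32 ^ (2 * (g + 2))) *
        (bernoulli (2 * g + 2)).den = (55 : ℕ) * p ^ 3 * (bernoulli (2 * g + 2)).num := by
  have : Fact p.Prime := ⟨hp⟩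
  have hp1 : p - 1 = 2 * (g + 2) := by omega
  have hsum := sq_mul_power_sum_eq (p := p) (m := 2 * g + 2) (by omega) (by omega)
  rw [hp1] at hsum
  have hcop : ∀ n, 0 < n → n < p → n.Coprime p := fun n h0 hn =>
    ((Nat.Prime.coprime_iff_not_dvd hp).2 (Nat.not_dvd_of_pos_of_lt h0 hn)).symm
  set q : ZMod (p ^ 4) := (p : ZMod (p ^ 4)) with hqdef
  have hq : q ^ 4 = 0 := by
    have := ZMod.natCast_self (p ^ 4)
    push_cast at this
    exact this
  have hqg : q = 2 * ((g + 2 : ℕ) : ZMod (p ^ 4)) + 1 := by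
    rw [hqdef]
    exact_mod_cast congrArg (Nat.cast : ℕ → ZMod (p ^ 4)) hpg
  have hu : ∀ i < 2 * (g + 2), ((i : ZMod (p ^ 4)) + 1) * ((i + 1 : ℕ) : ZMod (p ^ 4))⁻¹ = 1 := by
    intro i hi
    have := ZMod.coe_mul_inv_eq_one (i + 1) ((hcop (i + 1) (by omega) (by omega)).pow_right 4)
    push_cast at this ⊢
    exact this
  have hfermat : ∀ i < 2 * (g + 2), q ∣ ((i : ZMod (p ^ 4)) + 1) ^ (2 * (g + 2)) - 1 := by
    intro i hi
    obtain ⟨c, hc⟩ := Int.prime_dvd_pow_sub_one hp (n := ((i + 1 : ℕ) : ℤ))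
      (Int.isCoprime_iff_gcd_eq_one.2 (hcop (i + 1) (by omega) (by omega)))
    have hc' := congrArg (Int.cast : ℤ → ZMod (p ^ 4)) hc
    rw [hp1] at hc'
    push_cast at hc'
    exact ⟨c, hc'⟩
  have hx : q ∣ (4 : ZMod (p ^ 4)) ^ (g + 2) - 1 := by
    have := hfermat 1 (by omega)
    rw [pow_mul] at this
    norm_num at this
    exact this
  have unit2 : IsUnit (2 : ZMod (p ^ 4)) := by
    exact_mod_cast isUnit_natCast_zmod 4 (hcop 2 (by omega) (by omega))
  have unit3 : IsUnit (3 : ZMod (p ^ 4)) := by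
    exact_mod_cast isUnit_natCast_zmod 4 (hcop 3 (by omega) (by omega))
  have hden : (bernoulli (2 * g + 2)).den.Coprime p :=
    den_coprime_of_mem_integer (bernoulli_mem_integer (by omega))
  obtain ⟨s, hs⟩ := (isUnit_natCast_zmod 4 hden).exists_right_inv
  -- `β` is the image of the Bernoulli number, whose denominator has inverse `s`.
  obtain ⟨c, hc, hcβ⟩ := prod_even_eq_four_pow_add hq hqg hu unit3 hfermat
    (β := (bernoulli (2 * g + 2)).num * s) (by linear_combination s * hsum - q ^ 2 *
      (∑ j ∈ Finset.range (2 * (g + 2)), ((j : ZMod (p ^ 4)) + 1) ^ (2 * g + 2)) * hs)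
  obtain ⟨e3, e4, e5⟩ := alternating_power_sums hq hqg hu unit2 hx hc
  have h8 : (8 : ZMod (p ^ 4)) ^ (2 * (g + 2)) = (4 ^ (g + 2)) ^ 3 := by
    rw [pow_mul, pow_right_comm 4]
    norm_num
  have h16 : (16 : ZMod (p ^ 4)) ^ (2 * (g + 2)) = (4 ^ (g + 2)) ^ 4 := by
    rw [pow_mul, pow_right_comm 4]
    norm_num
  have h32 : (32 : ZMod (p ^ 4)) ^ (2 * (g + 2)) = (4 ^ (g + 2)) ^ 5 := by
    rw [pow_mul, pow_right_comm 4]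
    norm_num
  rw [h8, h16, h32, e4]
  have hd : 12 * (q ^ 3 * c) * (bernoulli (2 * g + 2)).den =
      q ^ 3 * (bernoulli (2 * g + 2)).num := by
    linear_combination ((bernoulli (2 * g + 2)).den : ZMod (p ^ 4)) * hcβ
      + q ^ 3 * (bernoulli (2 * g + 2)).num * hs
  push_cast
  refine ⟨?_, ?_, ?_⟩
  · linear_combination 4 * ((bernoulli (2 * g + 2)).den : ZMod (p ^ 4)) * e3 + 5 * hd
  · linear_combination 2 * hd
  · linear_combination 6 * ((bernoulli (2 * g + 2)).den : ZMod (p ^ 4)) * e5 + 55 * hd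

theorem corollary1p2 (p : ℕ) (hp : p.Prime) (hodd : Odd p) :
    RatModEq (p ^ 4)
      (∑ k ∈ Finset.range p, ((p - 1).choose k : ℚ) ^ 3)
      ((8 : ℚ) ^ (p - 1) + (5 / 8 : ℚ) * (p : ℚ) ^ 3 * bernoulli (p - 3)) ∧
    RatModEq (p ^ 4)
      (∑ k ∈ Finset.range p, (-1 : ℚ) ^ k * ((p - 1).choose k : ℚ) ^ 4)
      ((16 : ℚ) ^ (p - 1) + 2 * (p : ℚ) ^ 3 * bernoulli (p - 3)) ∧
    RatModEq (p ^ 4)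
      (∑ k ∈ Finset.range p, ((p - 1).choose k : ℚ) ^ 5)
      ((32 : ℚ) ^ (p - 1) + (55 / 12 : ℚ) * (p : ℚ) ^ 3 * bernoulli (p - 3)) := by
  rcases eq_or_ne p 3 with rfl | h3
  -- `55 / 12` is not `3`-integral, so `p = 3` is checked by hand.
  · refine ⟨⟨-7 / 8, ?_, ?_⟩, ⟨-4, ?_, ?_⟩, ⟨-55 / 4, ?_, ?_⟩⟩ <;>
      norm_num [Finset.sum_range_succ, Nat.choose_two_right]
  have : Fact p.Prime := ⟨hp⟩
  obtain ⟨g, hpg⟩ : ∃ g, p = 2 * (g + 2) + 1 := by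
    obtain ⟨t, ht⟩ := hodd
    have := hp.two_le
    exact ⟨t - 2, by omega⟩
  obtain ⟨e3, e4, e5⟩ := power_sums_zmod hp hpg
  have hden : (bernoulli (2 * g + 2)).den.Coprime p :=
    den_coprime_of_mem_integer (bernoulli_mem_integer (by omega))
  have h2p : Nat.Coprime 2 p := (Nat.coprime_primes Nat.prime_two hp).2 (by omega)
  have h3p : Nat.Coprime 3 p := (Nat.coprime_primes Nat.prime_three hp).2 (Ne.symm h3)
  have c3 := ratModEq_of_zmod (X := ∑ k ∈ Finset.range (2 * (g + 2) + 1),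
    ((2 * (g + 2)).choose k : ℤ) ^ 3) (Y := 8 ^ (2 * (g + 2))) (a := 5) (b := 8) (by norm_num)
    (h2p.pow_left 3) hden (by push_cast at e3 ⊢; exact e3)
  have c4 := ratModEq_of_zmod (X := ∑ k ∈ Finset.range (2 * (g + 2) + 1),
    (-1) ^ k * ((2 * (g + 2)).choose k : ℤ) ^ 4) (Y := 16 ^ (2 * (g + 2))) (a := 2) (b := 1)
    (by norm_num) (Nat.coprime_one_left p) hden (by push_cast at e4 ⊢; exact e4)
  have c5 := ratModEq_of_zmod (X := ∑ k ∈ Finset.range (2 * (g + 2) + 1),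
    ((2 * (g + 2)).choose k : ℤ) ^ 5) (Y := 32 ^ (2 * (g + 2))) (a := 55) (b := 12) (by norm_num)
    ((h2p.pow_left 2).mul_left h3p) hden (by push_cast at e5 ⊢; exact e5)
  push_cast [div_one] at c3 c4 c5
  rw [show p - 1 = 2 * (g + 2) by omega, show p - 3 = 2 * g + 2 by omega]
  rw [← hpg] at c3 c4 c5
  exact ⟨c3, c4, c5⟩
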